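/- Let $p$ be a prime and let $\Gamma=(V,E,\mathrm{wt},\nu)$ be a finite edge-weighted directed multigraph (loops and parallel edges allowed) in which each edge $e$, with source $e_s$ and target $e_t$, carries an indeterminate $\mathrm{wt}(e)$ as its weight and a voltage $\nu(e)\in\mathbb{Z}/p\mathbb{Z}$. Write $F[E]$ for the polynomial ring in the edge weights over a field $F$. The derived graph $\tilde\Gamma$ has vertex set $V\times\mathbb{Z}/p\mathbb{Z}$; each edge $e$ of $\Gamma$ and each $x\in\mathbb{Z}/p\mathbb{Z}$ give an edge of $\tilde\Gamma$ from $(e_s,x)$ to $(e_t,\nu(e)+x)$ of weight $\mathrm{wt}(e)$. The lifts of $v\in V$ are the vertices $(v,x)$. For a vertex $v$ of a weighted directed multigraph, $A_v$ denotes the sum, over all spanning trees $T$ directed towards $v$ (every vertex has a unique directed path in $T$ to $v$), of the product of the weights of the edges of $T$. Let $\zeta_p$ be a primitive $p$-th root of unity. The reduced group algebra $\mathbb{Z}[\mathbb{Z}/p\mathbb{Z}]/\langle\sum_g g\rangle$ is identified with $\mathbb{Z}[\zeta_p]$ by sending the generator $1\in\mathbb{Z}/p\mathbb{Z}$ to $\zeta_p$.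 The voltage Laplacian $\mathscr{L}(\Gamma)$ is the $V\times V$ matrix over $\mathbb{Q}(\zeta_p)[E]$ with entries $$\mathscr{L}(\Gamma)_{u,w}=\delta_{u,w}\sum_{e:\,e_s=u}\mathrm{wt}(e)-\sum_{e:\,e_s=u,\,e_t=w}\zeta_p^{\nu(e)}\,\mathrm{wt}(e).$$ Let $N_{\mathbb{Q}(\zeta_p)/\mathbb{Q}}:\mathbb{Q}(\zeta_p)[E]\to\mathbb{Q}[E]$ be the extension of the field norm that sends $\alpha$ to the determinant of multiplication by $\alpha$ on the free $\mathbb{Q}[E]$-module $\mathbb{Q}(\zeta_p)[E]$, and for $1\le i\le p-1$ let $\sigma_i$ be the automorphism of $\mathbb{Q}(\zeta_p)$ with $\sigma_i(\zeta_p)=\zeta_p^i$, acting on polynomials through their coefficients. Then for every vertex $v$ of $\Gamma$ and every lift $\tilde v$ of $v$ in $\tilde\Gamma$, $$p\,A_{\tilde v}(\tilde\Gamma)=A_v(\Gamma)\,N_{\mathbb{Q}(\zeta_p)/\mathbb{Q}}\bigl(\det\mathscr{L}(\Gamma)\bigr),\qquad N_{\mathbb{Q}(\zeta_p)/\mathbb{Q}}\bigl(\det\mathscr{L}(\Gamma)\bigr)=\prod_{i=1}^{p-1}\det\sigma_i(\mathscr{L}(\Gamma)).$$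 In particular, whenever $A_v(\Gamma)\neq 0$, $$\frac{A_{\tilde v}(\tilde\Gamma)}{A_v(\Gamma)}=\frac1p\,N_{\mathbb{Q}(\zeta_p)/\mathbb{Q}}\bigl(\det\mathscr{L}(\Gamma)\bigr)=\frac1p\prod_{i=1}^{p-1}\det\sigma_i(\mathscr{L}(\Gamma)).$$ -/

import Mathlib

namespace ArborescenceCover

noncomputable section

/-- A weighted directed multigraph with vertex type `V` and edge type `E` (loops and parallel edges
allowed). The weight of an edge is an indeterminate: `wt e` is the name of a variable in `σ`. Distinct
edges may or may not carry distinct variables; all lifts of an edge to a cover carry the same one. -/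
structure WeightedDigraph (V E σ : Type*) where
  src : E → V
  tgt : E → V
  wt : E → σ

/-- A weighted directed multigraph each of whose edges carries a voltage in the group `G`. -/
structure VoltageGraph (V E σ G : Type*) extends WeightedDigraph V E σ where
  ν : E → G

namespace WeightedDigraph

variable {V E σ : Type*} (Γ : WeightedDigraph V E σ)

/-- `Γ.IsWalk u w l`: the list of edges `l` is a directed path from `u` to `w`. -/
def IsWalk : V → V → List E → Prop
  | u, w, [] => u = w
  | u, w, e :: l => Γ.src e = u ∧ IsWalk (Γ.tgt e) w l

/-- The spanning subgraph with edge set `T` is an arborescence rooted at `v` : for every vertex `w`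
there is exactly one directed path in `T` from `w` to `v`. Paths may repeat vertices (as in Mathlib's
`Quiver.Path` and `Quiver.Arborescence`), so uniqueness excludes loops, cycles, and edges leaving
the root. -/
def IsArborescence (v : V) (T : Finset E) : Prop :=
  ∀ w : V, ∃! l : List E, Γ.IsWalk w v l ∧ ∀ e ∈ l, e ∈ T

open Classical in
/-- `A_v(Γ)`, the sum of the weights of the arborescences of `Γ` rooted at `v`, as a polynomial
in the edge weights with coefficients in `S`. -/
def arborescenceSum [Fintype E] (S : Type*) [CommRing S] (v : V) : MvPolynomial σ S :=
  ∑ T : Finset E with Γ.IsArborescence v T, ∏ e ∈ T, MvPolynomial.X (Γ.wt e)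

/-- The weighted (out-)degree matrix, with entries in `S[σ]`. -/
def degreeMatrix [DecidableEq V] [Fintype E] (S : Type*) [CommRing S] :
    Matrix V V (MvPolynomial σ S) :=
  Matrix.diagonal fun v => ∑ e : E with Γ.src e = v, MvPolynomial.X (Γ.wt e)

end WeightedDigraph

/-- The reduced group algebra `R[G] / ⟨∑ g⟩` of a finite (here: commutative) group. -/
abbrev ReducedGroupAlgebra (R G : Type*) [CommRing R] [CommGroup G] [Fintype G] : Type _ :=
  MonoidAlgebra R G ⧸ Ideal.span {∑ g : G, (MonoidAlgebra.of R G g : MonoidAlgebra R G)}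

namespace VoltageGraph

variable {V E σ G : Type*}

/-- The derived graph: vertices `V × G`, edges `E × G`, the edge `(e, x)` goes from `(src e, x)` to
`(tgt e, ν e * x)` and has the same weight as `e`. The lifts of `v` are the vertices `(v, x)`. -/
def derived [Group G] (Γ : VoltageGraph V E σ G) : WeightedDigraph (V × G) (E × G) σ where
  src e := (Γ.src e.1, e.2)
  tgt e := (Γ.tgt e.1, Γ.ν e.1 * e.2)
  wt e := Γ.wt e.1

variable [CommGroup G] [Fintype G]

/-- The voltage of an edge as an element of the reduced group algebra over `ℤ`. -/
def voltage (Γ : VoltageGraph V E σ G) (e : E) : ReducedGroupAlgebra ℤ G :=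
  Ideal.Quotient.mk _ (MonoidAlgebra.of ℤ G (Γ.ν e))

/-- The voltage adjacency matrix: the `(i, j)` entry is the sum of `ν(e) wt(e)` over the edges `e`
from `i` to `j`. -/
def voltageAdjacency [DecidableEq V] [Fintype E] (Γ : VoltageGraph V E σ G) :
    Matrix V V (MvPolynomial σ (ReducedGroupAlgebra ℤ G)) :=
  Matrix.of fun i j => ∑ e : E with Γ.src e = i ∧ Γ.tgt e = j,
    MvPolynomial.C (Γ.voltage e) * MvPolynomial.X (Γ.wt e)

/-- The voltage Laplacian matrix. -/
def voltageLaplacian [DecidableEq V] [Fintype E] (Γ : VoltageGraph V E σ G) :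
    Matrix V V (MvPolynomial σ (ReducedGroupAlgebra ℤ G)) :=
  Γ.degreeMatrix (ReducedGroupAlgebra ℤ G) - Γ.voltageAdjacency

end VoltageGraph

section Cyclotomic

variable (p : ℕ) [Fact p.Prime] {K : Type*} [Field K]

/-- The ring homomorphism `ℤ[ℤ/pℤ] → K` sending the generator of `ℤ/pℤ` to `ζ`. -/
def groupAlgebraToField {ζ : K} (hζ : IsPrimitiveRoot ζ p) :
    MonoidAlgebra ℤ (Multiplicative (ZMod p)) →ₐ[ℤ] K :=
  MonoidAlgebra.lift ℤ K (Multiplicative (ZMod p)) (AddChar.zmodChar p hζ.pow_eq_one).toMonoidHom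

theorem groupAlgebraToField_of {ζ : K} (hζ : IsPrimitiveRoot ζ p) (x : Multiplicative (ZMod p)) :
    groupAlgebraToField p hζ (MonoidAlgebra.of ℤ _ x) = ζ ^ (x.toAdd).val := by
  rw [groupAlgebraToField, MonoidAlgebra.lift_of]
  exact AddChar.zmodChar_apply hζ.pow_eq_one x.toAdd

theorem groupAlgebraToField_sum {ζ : K} (hζ : IsPrimitiveRoot ζ p) :
    groupAlgebraToField p hζ (∑ g, MonoidAlgebra.of ℤ (Multiplicative (ZMod p)) g) = 0 := by
  have h1 : (AddChar.zmodChar p hζ.pow_eq_one) ≠ 0 := by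
    intro h
    have h2 := AddChar.zmodChar_apply' (n := p) hζ.pow_eq_one 1
    rw [h] at h2
    simp at h2
    exact hζ.ne_one (Fact.out : p.Prime).one_lt h2.symm
  rw [map_sum]
  have h3 := AddChar.sum_eq_zero_of_ne_one h1
  rw [← h3, groupAlgebraToField]
  refine Fintype.sum_equiv Multiplicative.toAdd _ _ fun x => ?_
  rw [MonoidAlgebra.lift_of]
  rfl

/-- The identification of the reduced group algebra of `ℤ/pℤ` with (the subring `ℤ[ζ]` of) the
`p`-th cyclotomic field: the generator of `ℤ/pℤ` goes to `ζ`. -/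
def reducedToField {ζ : K} (hζ : IsPrimitiveRoot ζ p) :
    ReducedGroupAlgebra ℤ (Multiplicative (ZMod p)) →+* K :=
  Ideal.Quotient.lift _ (groupAlgebraToField p hζ).toRingHom fun a ha => by
    refine (Ideal.span_le (I := RingHom.ker (groupAlgebraToField p hζ).toRingHom)).2 ?_ ha
    rintro _ rfl
    exact groupAlgebraToField_sum p hζ

/-- The voltage Laplacian of a `ℤ/pℤ`-voltage graph as a matrix over `ℚ(ζ_p)[σ]`. -/
def cyclotomicLaplacian {V E σ : Type*} [DecidableEq V] [Fintype E] {ζ : K}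
    (hζ : IsPrimitiveRoot ζ p) (Γ : VoltageGraph V E σ (Multiplicative (ZMod p))) :
    Matrix V V (MvPolynomial σ K) :=
  Γ.voltageLaplacian.map (MvPolynomial.map (reducedToField p hζ))

/-- The automorphism `σ_i` of the `p`-th cyclotomic field that raises `p`-th roots of unity to the
power `i`, for `i` prime to `p` (and, as a dummy value, the identity otherwise). -/
def cyclotomicAut (K : Type*) [Field K] [NumberField K] [IsCyclotomicExtension {p} ℚ K] (i : ℕ) :
    K ≃ₐ[ℚ] K :=
  if h : i.Coprime p then
    (IsCyclotomicExtension.Rat.galEquivZMod p K).symm (ZMod.unitOfCoprime i h)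
  else AlgEquiv.refl

theorem cyclotomicAut_apply [NumberField K] [IsCyclotomicExtension {p} ℚ K] {ζ : K}
    (hζ : IsPrimitiveRoot ζ p) {i : ℕ} (h : i.Coprime p) : cyclotomicAut p K i ζ = ζ ^ i := by
  rw [IsCyclotomicExtension.Rat.galEquivZMod_apply_of_pow_eq p K _ hζ.pow_eq_one, cyclotomicAut,
    dif_pos h, MulEquiv.apply_symm_apply, ZMod.coe_unitOfCoprime, ZMod.val_natCast,
    ← pow_eq_pow_mod i hζ.pow_eq_one]

/-- The norm of `K` over `ℚ` extended to polynomial rings: the norm of the free extension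
`K[σ]` of `ℚ[σ]`, that is, the determinant of multiplication by the given element. -/
def polynomialNorm (σ : Type*) (K : Type*) [Field K] [NumberField K] :
    MvPolynomial σ K →* MvPolynomial σ ℚ :=
  letI : Algebra (MvPolynomial σ ℚ) (MvPolynomial σ K) := MvPolynomial.algebraMvPolynomial
  Algebra.norm (MvPolynomial σ ℚ)

end Cyclotomic

end

end ArborescenceCover

/-! By the directed matrix-tree theorem, `A_v` is the `(v, v)` entry of the adjugate of the
Laplacian. The Laplacian of the derived graph commutes with translation by the voltage group, so a
character table block-diagonalizes it, with one block per character: the Laplacian of `Γ` twisted by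
that character (`derived_twistedLaplacian_mul`). The trivial character gives the ordinary Laplacian,
which is singular, so determinants alone say nothing. Instead `X` is added to the diagonal at every
lift of `v` and both sides are differentiated at `X = 0`. One side becomes the sum of the adjugate
entries at the lifts of `v`, all equal. On the other, only the term differentiating the singular
factor survives, giving `A_v(Γ)` times the determinants of the nontrivial twists
(`card_mul_adjugate_derived_twistedLaplacian`). For `ℤ/pℤ` the nontrivial twists are the Galois
conjugates of the voltage Laplacian, and the product of conjugates is the norm
(`map_polynomialNorm`). -/

namespace ArborescenceCover

noncomputable section

/-! ### Determinants attached to self-maps with a fixed point. -/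

section FunctionMatrix

variable {V R : Type*} [Fintype V] [DecidableEq V] [CommRing R]

/-- The matrix of a self-map of `V`, restricted to the complement of `v`. -/
def functionMatrix (R : Type*) [CommRing R] (v : V) (f : V → V) :
    Matrix {u : V // u ≠ v} {u : V // u ≠ v} R :=
  Matrix.of fun u w => if f u = w then 1 else 0

theorem functionMatrix_mulVec (v : V) (f : V → V) (s : V → R) (hs : s v = 0)
    (u : {u : V // u ≠ v}) :
    (functionMatrix R v f).mulVec (fun w => s w) u = s (f u) := by
  simp only [Matrix.mulVec, dotProduct, functionMatrix, Matrix.of_apply, ite_mul, one_mul,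
    zero_mul]
  by_cases h : f u = v
  · rw [h, hs]
    exact Finset.sum_eq_zero fun w _ => if_neg fun h' => w.2 h'.symm
  · rw [Finset.sum_eq_single ⟨f u, h⟩]
    · simp
    · intro w _ hw
      exact if_neg fun h' => hw (Subtype.ext h'.symm)
    · simp

theorem functionMatrix_pow_apply {v : V} {f : V → V} (hf : f v = v) (n : ℕ)
    (u w : {u : V // u ≠ v}) :
    (functionMatrix R v f ^ n) u w = if f^[n] u = w then 1 else 0 := by
  induction n generalizing u with
  | zero =>
    simp only [pow_zero, Matrix.one_apply, Subtype.ext_iff, Function.iterate_zero, id]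
    congr
  | succ n ih =>
    rw [pow_succ', Matrix.mul_apply, Function.iterate_succ_apply,
      ← functionMatrix_mulVec v f (fun j => if f^[n] j = w then (1 : R) else 0)]
    · exact Finset.sum_congr rfl fun j _ => by rw [ih]
    · rw [Function.iterate_fixed hf, if_neg w.2.symm]

theorem isNilpotent_functionMatrix {v : V} {f : V → V} (hf : f v = v)
    (h : ∀ u, ∃ n, f^[n] u = v) : IsNilpotent (functionMatrix R v f) := by
  choose n hn using h
  -- A common bound on the hitting times; overshooting is harmless because `f` fixes `v`.
  refine ⟨Finset.univ.sup n, ?_⟩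
  ext u w
  obtain ⟨k, hk⟩ := Nat.exists_eq_add_of_le' (Finset.le_sup (f := n) (Finset.mem_univ u.1))
  rw [functionMatrix_pow_apply hf, hk, Function.iterate_add_apply, hn, Function.iterate_fixed hf,
    if_neg w.2.symm, Matrix.zero_apply]

/-- For nilpotent `N`, `det (1 - X N)` is a unit of `R[X]`, hence constant over a domain, so its
values at `0` and `1` agree. -/
theorem det_one_sub_of_isNilpotent [IsDomain R] {N : Matrix V V R} (hN : IsNilpotent N) :
    (1 - N).det = 1 := by
  obtain ⟨r, -, hr⟩ := Polynomial.isUnit_iff.1 (Matrix.isUnit_charpolyRev_of_isNilpotent hN)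
  have h0 := N.eval_charpolyRev
  have h1 : Polynomial.eval 1 N.charpolyRev = (1 - N).det := by
    rw [Matrix.charpolyRev, ← Polynomial.coe_evalRingHom, RingHom.map_det]
    congr 1
    ext i j
    rcases eq_or_ne i j with hij | hij <;> simp [hij]
  rw [← hr, Polynomial.eval_C] at h0 h1
  rw [← h1, h0]

open Classical in
theorem det_one_sub_functionMatrix [IsDomain R] {v : V} {f : V → V} (hf : f v = v) :
    (1 - functionMatrix R v f).det = if ∀ u, ∃ n, f^[n] u = v then 1 else 0 := by
  split_ifs with h
  · exact det_one_sub_of_isNilpotent (isNilpotent_functionMatrix hf h)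
  · push Not at h
    obtain ⟨u, hu⟩ := h
    -- The indicator of the vertices that never reach `v` is invariant under `f` and vanishes at
    -- `v`, so it restricts to a kernel vector.
    let s : V → R := fun w => if ∃ n, f^[n] w = v then 0 else 1
    have hu' : ¬ ∃ n, f^[n] u = v := by simpa using hu
    refine Matrix.exists_mulVec_eq_zero_iff.1 ⟨fun w => s w, fun h0 => ?_, ?_⟩
    · have := congrFun h0 ⟨u, hu 0⟩
      simp only [s, Pi.zero_apply, if_neg hu'] at this
      exact one_ne_zero this
    · ext w
      rw [Matrix.sub_mulVec, Matrix.one_mulVec, Pi.sub_apply,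
        functionMatrix_mulVec v f s (if_pos ⟨0, rfl⟩), Pi.zero_apply, sub_eq_zero]
      have : (∃ n, f^[n] w = v) ↔ ∃ n, f^[n] (f w) = v := by
        refine ⟨fun ⟨n, hn⟩ => ?_, fun ⟨n, hn⟩ => ⟨n + 1, hn⟩⟩
        cases n with
        | zero => exact absurd hn w.2
        | succ n => exact ⟨n, hn⟩
      simp only [s, this]

end FunctionMatrix

/-! ### Arborescences as edge choices; the directed matrix-tree theorem. -/

namespace WeightedDigraph

variable {V E σ : Type*} (Γ : WeightedDigraph V E σ)

section Choice

variable [DecidableEq V] {v : V}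

/-- The self-map of `V` that fixes `v` and follows the edge `φ u` from `u ≠ v`. -/
def successor (φ : {u : V // u ≠ v} → E) (u : V) : V :=
  if h : u = v then v else Γ.tgt (φ ⟨u, h⟩)

theorem successor_root (φ : {u : V // u ≠ v} → E) : Γ.successor φ v = v :=
  dif_pos rfl

theorem successor_of_ne (φ : {u : V // u ≠ v} → E) (u : {u : V // u ≠ v}) :
    Γ.successor φ u = Γ.tgt (φ u) :=
  dif_neg u.2

variable {φ : {u : V // u ≠ v} → E} (hφ : ∀ u, Γ.src (φ u) = u)
include hφ

-- At most one chosen edge leaves each vertex and none leaves `v`, so every step of a walk, and its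
-- end, is forced.
omit [DecidableEq V] in
theorem walk_in_range_unique {w : V} {l l' : List E}
    (h : Γ.IsWalk w v l) (hl : ∀ e ∈ l, e ∈ Set.range φ)
    (h' : Γ.IsWalk w v l') (hl' : ∀ e ∈ l', e ∈ Set.range φ) : l = l' := by
  induction l generalizing w l' with
  | nil =>
    cases l' with
    | nil => rfl
    | cons e t =>
      obtain ⟨u, rfl⟩ := hl' e (by simp)
      exact absurd ((hφ u).symm.trans (h'.1.trans h)) u.2
  | cons e t ih =>
    obtain ⟨u, rfl⟩ := hl e (by simp)
    cases l' with
    | nil => exact absurd ((hφ u).symm.trans (h.1.trans h')) u.2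
    | cons e' t' =>
      obtain ⟨u', rfl⟩ := hl' e' (by simp)
      obtain rfl : u = u' := Subtype.ext <| by rw [← hφ u, ← hφ u', h.1, h'.1]
      rw [ih h.2 (fun e he => hl e (by simp [he])) h'.2 (fun e he => hl' e (by simp [he]))]

theorem exists_iterate_successor_of_walk {w : V} {l : List E}
    (h : Γ.IsWalk w v l) (hl : ∀ e ∈ l, e ∈ Set.range φ) : ∃ n, (Γ.successor φ)^[n] w = v := by
  induction l generalizing w with
  | nil => exact ⟨0, h⟩
  | cons e t ih =>
    obtain ⟨u, rfl⟩ := hl e (by simp)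
    obtain ⟨n, hn⟩ := ih h.2 fun e he => hl e (by simp [he])
    refine ⟨n + 1, ?_⟩
    rw [Function.iterate_succ_apply, ← h.1, hφ, successor_of_ne, hn]

theorem exists_walk_of_iterate_successor {n : ℕ} {w : V} (h : (Γ.successor φ)^[n] w = v) :
    ∃ l : List E, Γ.IsWalk w v l ∧ ∀ e ∈ l, e ∈ Set.range φ := by
  induction n generalizing w with
  | zero => exact ⟨[], h, by simp⟩
  | succ n ih =>
    by_cases hw : w = v
    · exact ⟨[], hw, by simp⟩
    · obtain ⟨l, hl, hlφ⟩ := ih h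
      refine ⟨φ ⟨w, hw⟩ :: l, ⟨hφ _, ?_⟩, ?_⟩
      · rwa [← successor_of_ne]
      · exact List.forall_mem_cons.2 ⟨⟨_, rfl⟩, hlφ⟩

theorem isArborescence_image_iff [Fintype V] [DecidableEq E] :
    Γ.IsArborescence v (Finset.univ.image φ) ↔ ∀ w, ∃ n, (Γ.successor φ)^[n] w = v := by
  have hmem : ∀ e, e ∈ Finset.univ.image φ ↔ e ∈ Set.range φ := by simp
  simp only [IsArborescence, hmem]
  refine forall_congr' fun w => ⟨fun ⟨l, hl, _⟩ => ?_, fun ⟨n, hn⟩ => ?_⟩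
  · exact Γ.exists_iterate_successor_of_walk hφ hl.1 hl.2
  · obtain ⟨l, hl⟩ := Γ.exists_walk_of_iterate_successor hφ hn
    exact ⟨l, hl, fun l' hl' => Γ.walk_in_range_unique hφ hl'.1 hl'.2 hl.1 hl.2⟩

end Choice

theorem IsArborescence.exists_image_eq {Γ : WeightedDigraph V E σ} [Fintype V] [DecidableEq V]
    [DecidableEq E] {v : V} {T : Finset E} (hT : Γ.IsArborescence v T) :
    ∃ φ : {u : V // u ≠ v} → E, (∀ u, Γ.src (φ u) = u) ∧ Finset.univ.image φ = T := by
  -- Prepending `e` to the walk from its target gives a walk in `T`, hence the unique one from its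
  -- source. So two edges of `T` with a common source coincide, and none leaves `v`.
  have key : ∀ e ∈ T, ∀ l, (Γ.IsWalk (Γ.src e) v l ∧ ∀ e ∈ l, e ∈ T) → l.head? = some e := by
    intro e he l hl
    obtain ⟨t, ht, -⟩ := hT (Γ.tgt e)
    rw [(hT (Γ.src e)).unique hl (y₂ := e :: t) ⟨⟨rfl, ht.1⟩, by simpa [he] using ht.2⟩]
    rfl
  have hex : ∀ u : {u : V // u ≠ v}, ∃ e ∈ T, Γ.src e = u := by
    intro u
    obtain ⟨l, hl, -⟩ := hT u
    cases l with
    | nil => exact absurd hl.1 u.2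
    | cons e t => exact ⟨e, hl.2 e (by simp), hl.1.1⟩
  choose φ hφT hφ using hex
  refine ⟨φ, hφ, ?_⟩
  ext e
  simp only [Finset.mem_image, Finset.mem_univ, true_and]
  refine ⟨fun ⟨u, hu⟩ => hu ▸ hφT u, fun he => ?_⟩
  have hne : Γ.src e ≠ v := by
    intro h
    simpa using key e he [] ⟨h, by simp⟩
  obtain ⟨l, hl, -⟩ := hT (Γ.src e)
  refine ⟨⟨Γ.src e, hne⟩, ?_⟩
  have h1 := key e he l hl
  have h2 := key (φ ⟨Γ.src e, hne⟩) (hφT _) l (by rwa [hφ])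
  exact Option.some_injective _ (h2.symm.trans h1)

section Laplacian

variable {R : Type*} [CommRing R] [DecidableEq V] [Fintype E]

/-- The Laplacian matrix for edge weights `a`, in which the adjacency part is twisted by the
coefficients `c`. -/
def twistedLaplacian (a c : E → R) : Matrix V V R :=
  Matrix.of fun u w => ∑ e : E with Γ.src e = u,
    a e * ((if u = w then 1 else 0) - if Γ.tgt e = w then c e else 0)

variable [Fintype V]

open Classical in
/-- The directed matrix-tree theorem, for the Laplacian with the row and the column of the root
deleted. -/
theorem det_submatrix_twistedLaplacian_one [IsDomain R] (a : E → R) (v : V) :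
    ((Γ.twistedLaplacian a 1).submatrix
        (Subtype.val : {u : V // u ≠ v} → V) (Subtype.val : {u : V // u ≠ v} → V)).det =
      ∑ T : Finset E with Γ.IsArborescence v T, ∏ e ∈ T, a e := by
  let A (u : {u : V // u ≠ v}) : Finset E := {e : E | Γ.src e = u}
  let g (u : {u : V // u ≠ v}) (e : E) (w : {u : V // u ≠ v}) : R :=
    (if u = w then 1 else 0) - if Γ.tgt e = w then 1 else 0
  have hM : (Γ.twistedLaplacian a 1).submatrix
      (Subtype.val : {u : V // u ≠ v} → V) (Subtype.val : {u : V // u ≠ v} → V) =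
      fun u => ∑ e ∈ A u, a e • g u e := by
    ext u w
    simp [twistedLaplacian, A, g, Finset.sum_apply, Subtype.ext_iff]
  have hdet (φ : {u : V // u ≠ v} → E) :
      Matrix.detRowAlternating (fun u => g u (φ u)) =
        if ∀ u, ∃ n, (Γ.successor φ)^[n] u = v then (1 : R) else 0 := by
    rw [← det_one_sub_functionMatrix (Γ.successor_root φ)]
    change Matrix.det _ = _
    congr 1
    ext u w
    simp [g, functionMatrix, Matrix.one_apply, successor_of_ne]
  have hA (φ : {u : V // u ≠ v} → E) : φ ∈ Fintype.piFinset A ↔ ∀ u, Γ.src (φ u) = u := by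
    simp [A]
  rw [hM]
  change Matrix.detRowAlternating.toMultilinearMap _ = _
  -- Row `u` is a sum over the edges leaving `u`, so multilinearity expands the determinant over
  -- choices of one outgoing edge per non-root vertex. By `hdet` each choice contributes its weight
  -- or zero.
  rw [MultilinearMap.map_sum_finset]
  simp only [MultilinearMap.map_smul_univ, AlternatingMap.coe_multilinearMap, hdet, smul_eq_mul,
    mul_ite, mul_one, mul_zero]
  rw [← Finset.sum_filter]
  refine Finset.sum_bij (fun φ _ => Finset.univ.image φ) ?_ ?_ ?_ ?_
  · intro φ h
    rw [Finset.mem_filter, hA] at h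
    simpa using (Γ.isArborescence_image_iff h.1).2 h.2
  · intro φ h φ' h' heq
    rw [Finset.mem_filter, hA] at h h'
    ext u
    have hu : φ u ∈ Finset.univ.image φ' := heq ▸ Finset.mem_image_of_mem φ (Finset.mem_univ u)
    obtain ⟨u', -, hu'⟩ := Finset.mem_image.1 hu
    obtain rfl : u' = u := Subtype.ext <| by rw [← h'.1, ← h.1, hu']
    exact hu'.symm
  · intro T hT
    rw [Finset.mem_filter] at hT
    obtain ⟨φ, hφ, rfl⟩ := hT.2.exists_image_eq
    exact ⟨φ, by
      rw [Finset.mem_filter, hA]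
      exact ⟨hφ, (Γ.isArborescence_image_iff hφ).1 hT.2⟩, rfl⟩
  · intro φ h
    rw [Finset.mem_filter, hA] at h
    rw [Finset.prod_image]
    intro u _ u' _ huu'
    exact Subtype.ext <| by rw [← h.1 u, ← h.1 u', huu']

theorem adjugate_apply_self (M : Matrix V V R) (v : V) :
    M.adjugate v v = (M.submatrix (Subtype.val : {u : V // u ≠ v} → V)
      (Subtype.val : {u : V // u ≠ v} → V)).det := by
  rw [Matrix.adjugate_apply, Matrix.twoBlockTriangular_det _ (· ≠ v)]
  · have : (Matrix.toSquareBlockProp (M.updateRow v (Pi.single v 1)) fun u => ¬ u ≠ v) = 1 := by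
      ext ⟨i, hi⟩ ⟨j, hj⟩
      obtain rfl := not_not.1 hi
      obtain rfl := not_not.1 hj
      simp [Matrix.toSquareBlockProp_def]
    rw [this, Matrix.det_one, mul_one]
    congr 1
    ext i j
    simp [Matrix.toSquareBlockProp_def, Matrix.updateRow_ne i.2]
  · intro i hi j hj
    obtain rfl := not_not.1 hi
    simp [hj]

/-- The directed matrix-tree theorem. -/
theorem adjugate_twistedLaplacian_one [IsDomain R] (v : V) :
    (Γ.twistedLaplacian (fun e => MvPolynomial.X (R := R) (Γ.wt e)) 1).adjugate v v =
      Γ.arborescenceSum R v := by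
  rw [adjugate_apply_self, det_submatrix_twistedLaplacian_one]
  rfl

/-- Untwisted rows sum to zero, so the all-ones vector is in the kernel. -/
theorem det_twistedLaplacian_one [IsDomain R] [Nonempty V] (a : E → R) :
    (Γ.twistedLaplacian a 1).det = 0 := by
  refine Matrix.exists_mulVec_eq_zero_iff.1 ⟨1, one_ne_zero, ?_⟩
  ext u
  simp only [Matrix.mulVec, dotProduct, twistedLaplacian, Matrix.of_apply, Pi.one_apply, mul_one,
    Pi.zero_apply]
  rw [Finset.sum_comm]
  refine Finset.sum_eq_zero fun e _ => ?_
  simp [← Finset.mul_sum]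

end Laplacian

end WeightedDigraph

/-! ### First-order perturbation of determinants. -/

open Polynomial in
theorem derivative_det {n R : Type*} [Fintype n] [DecidableEq n] [CommRing R]
    (A : Matrix n n R[X]) :
    derivative A.det = ∑ i, (A.updateRow i fun j => derivative (A i j)).det := by
  -- After transposing, the factor indexed by `i` in the Leibniz formula comes from row `i`, so
  -- updating a row changes exactly one factor.
  simp only [← Matrix.det_transpose (M := A), ← Matrix.det_transpose (M := A.updateRow _ _),
    Matrix.det_apply', derivative_sum]
  rw [Finset.sum_comm]
  refine Finset.sum_congr rfl fun τ _ => ?_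
  rw [derivative_mul, derivative_intCast, zero_mul, zero_add, derivative_prod_finset,
    Finset.mul_sum]
  refine Finset.sum_congr rfl fun i _ => ?_
  rw [← Finset.mul_prod_erase _ _ (Finset.mem_univ i), mul_comm (Finset.prod _ _)]
  congr 2
  · simp
  · refine Finset.prod_congr rfl fun j hj => ?_
    simp [Matrix.updateRow_ne (Finset.ne_of_mem_erase hj)]

open Polynomial in
theorem eval_zero_derivative_det_add_diagonal {n R : Type*} [Fintype n] [DecidableEq n]
    [CommRing R] (M : Matrix n n R) (d : n → R) :
    (derivative (M.map C + Matrix.diagonal fun i => X * C (d i)).det).eval 0 =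
      ∑ i, d i * M.adjugate i i := by
  rw [derivative_det, eval_finsetSum]
  refine Finset.sum_congr rfl fun i _ => ?_
  rw [← coe_evalRingHom, RingHom.map_det, Matrix.adjugate_apply, ← Matrix.det_updateRow_smul]
  congr 1
  ext k j
  by_cases hk : k = i
  · subst hk
    by_cases hj : k = j
    · subst hj
      simp
    · simp [hj, Ne.symm hj]
  · by_cases hj : k = j
    · subst hj
      simp [Matrix.updateRow_ne hk]
    · simp [Matrix.updateRow_ne hk, hj]

open Polynomial in
theorem eval_zero_det_add_diagonal {n R : Type*} [Fintype n] [DecidableEq n]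
    [CommRing R] (M : Matrix n n R) (d : n → R) :
    (M.map C + Matrix.diagonal fun i => X * C (d i)).det.eval 0 = M.det := by
  rw [← coe_evalRingHom, RingHom.map_det]
  congr 1
  ext i j
  by_cases hj : i = j
  · subst hj
    simp
  · simp [hj]

/-! ### Laplacians of covers and characters of the voltage group. -/

namespace WeightedDigraph

variable {V E σ R S : Type*} [CommRing R] [CommRing S] [DecidableEq V] [Fintype E]

theorem twistedLaplacian_map (Γ : WeightedDigraph V E σ) (a c : E → R) (f : R →+* S) :
    (Γ.twistedLaplacian a c).map f = Γ.twistedLaplacian (f ∘ a) (f ∘ c) := by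
  ext u w
  simp [twistedLaplacian, apply_ite f]

end WeightedDigraph

namespace VoltageGraph

variable {V E σ G R : Type*} [Fintype V] [DecidableEq V] [Fintype E] [CommGroup G] [Fintype G]
  [DecidableEq G] [CommRing R] (Γ : VoltageGraph V E σ G)

omit [Fintype V] in
theorem derived_twistedLaplacian_apply (a : E → R) (u w : V) (x y : G) :
    Γ.derived.twistedLaplacian (fun e => a e.1) 1 (u, x) (w, y) =
      ∑ e : E with Γ.src e = u, a e *
        ((if u = w ∧ x = y then 1 else 0) - if Γ.tgt e = w ∧ Γ.ν e * x = y then 1 else 0) := by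
  simp only [WeightedDigraph.twistedLaplacian, Matrix.of_apply, Finset.sum_filter, derived,
    Fintype.sum_prod_type, Prod.mk.injEq, Pi.one_apply]
  refine Finset.sum_congr rfl fun e _ => ?_
  by_cases h : Γ.src e = u <;> simp [h]

/-- Right translation by `x` is an automorphism of the derived graph, since voltages multiply on the
left. -/
theorem derived_adjugate_twistedLaplacian (a : E → R) (v : V) (x : G) :
    (Γ.derived.twistedLaplacian (fun e => a e.1) 1).adjugate (v, x) (v, x) =
      (Γ.derived.twistedLaplacian (fun e => a e.1) 1).adjugate (v, 1) (v, 1) := by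
  let τ : V × G ≃ V × G := (Equiv.refl V).prodCongr (Equiv.mulRight x)
  have h : (Γ.derived.twistedLaplacian (fun e => a e.1) 1).submatrix τ τ =
      Γ.derived.twistedLaplacian (fun e => a e.1) 1 := by
    ext ⟨u, y⟩ ⟨w, z⟩
    simp [τ, derived_twistedLaplacian_apply, ← mul_assoc]
  have h' := congrFun (congrFun
    (Matrix.adjugate_submatrix_equiv_self τ (Γ.derived.twistedLaplacian (fun e => a e.1) 1))
    (v, 1)) (v, 1)
  rw [h] at h'
  simpa [τ] using h'.symm

/-- A character table block-diagonalizes the Laplacian of the derived graph. -/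
theorem derived_twistedLaplacian_mul (a : E → R) (d : V → R) (χ : G → G →* R) :
    (Γ.derived.twistedLaplacian (fun e => a e.1) 1 + Matrix.diagonal fun q : V × G => d q.1) *
        Matrix.kroneckerMap (· * ·) (1 : Matrix V V R) (Matrix.of fun x i => χ i x) =
      Matrix.kroneckerMap (· * ·) (1 : Matrix V V R) (Matrix.of fun x i => χ i x) *
        Matrix.blockDiagonal fun i =>
          Γ.twistedLaplacian a (fun e => χ i (Γ.ν e)) + Matrix.diagonal d := by
  ext ⟨u, x⟩ ⟨w, i⟩
  rw [add_mul, Matrix.add_apply, Matrix.diagonal_mul]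
  simp only [Matrix.mul_apply, Fintype.sum_prod_type, Matrix.kroneckerMap_apply,
    Matrix.one_apply, Matrix.of_apply, ite_mul, one_mul, zero_mul, Matrix.blockDiagonal_apply,
    mul_ite, mul_zero, Finset.sum_ite_eq, Finset.sum_ite_eq', Finset.mem_univ, if_true,
    Matrix.add_apply, Matrix.diagonal_apply, Finset.sum_ite_irrel, Finset.sum_const_zero,
    derived_twistedLaplacian_apply]
  rw [mul_add, WeightedDigraph.twistedLaplacian, Matrix.of_apply, Finset.mul_sum]
  congr 1
  · simp only [Finset.sum_mul]
    rw [Finset.sum_comm]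
    refine Finset.sum_congr rfl fun e _ => ?_
    simp only [mul_assoc, ← Finset.mul_sum, sub_mul, Finset.sum_sub_distrib, ite_and, ite_mul,
      one_mul, zero_mul, Finset.sum_ite_irrel, Finset.sum_const_zero, Finset.sum_ite_eq,
      Finset.mem_univ, if_true, map_mul]
    split_ifs <;> ring
  · split_ifs <;> ring

theorem det_derived_twistedLaplacian_add_diagonal [IsDomain R] (a : E → R) (d : V → R)
    (χ : G → G →* R) (hχ : (Matrix.of fun x i => χ i x).det ≠ 0) :
    (Γ.derived.twistedLaplacian (fun e => a e.1) 1 + Matrix.diagonal fun q : V × G => d q.1).det =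
      ∏ i, (Γ.twistedLaplacian a (fun e => χ i (Γ.ν e)) + Matrix.diagonal d).det := by
  have h := congrArg Matrix.det (Γ.derived_twistedLaplacian_mul a d χ)
  have hF : (Matrix.kroneckerMap (· * ·) (1 : Matrix V V R) (Matrix.of fun x i => χ i x)).det ≠ 0 := by
    rw [Matrix.det_kronecker]
    simpa using pow_ne_zero _ hχ
  rw [Matrix.det_mul, Matrix.det_mul, mul_comm, Matrix.det_blockDiagonal] at h
  exact mul_left_cancel₀ hF h

open Polynomial in
/-- The adjugates of the Laplacians of a voltage graph and of its derived graph. -/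
theorem card_mul_adjugate_derived_twistedLaplacian [IsDomain R] (a : E → R)
    (χ : G → G →* R) (hχ : (Matrix.of fun x i => χ i x).det ≠ 0) (hχ1 : χ 1 = 1)
    (v : V) (x : G) :
    (Fintype.card G : R) *
        (Γ.derived.twistedLaplacian (fun e => a e.1) 1).adjugate (v, x) (v, x) =
      (Γ.twistedLaplacian a 1).adjugate v v *
        ∏ i ∈ Finset.univ.erase 1, (Γ.twistedLaplacian a fun e => χ i (Γ.ν e)).det := by
  have : Nonempty V := ⟨v⟩
  -- Pulled back to the cover, this `d` marks all lifts of `v`, so the perturbation is still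
  -- block-diagonalized.
  let d : V → R := Pi.single v 1
  have hχ' : (Matrix.of fun x i => ((C : R →+* R[X]).toMonoidHom.comp (χ i)) x).det ≠ 0 := by
    have h : (Matrix.of fun x i => ((C : R →+* R[X]).toMonoidHom.comp (χ i)) x) =
      (C : R →+* R[X]).mapMatrix (Matrix.of fun x i => χ i x) := rfl
    rw [h, ← RingHom.map_det]
    exact C_ne_zero.2 hχ
  have key := Γ.det_derived_twistedLaplacian_add_diagonal (fun e => C (a e))
    (fun u => X * C (d u)) (fun i => (C : R →+* R[X]).toMonoidHom.comp (χ i)) hχ'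
  have h1 : Γ.derived.twistedLaplacian (fun e => C (a e.1)) 1 =
      (Γ.derived.twistedLaplacian (fun e => a e.1) 1).map C := by
    rw [WeightedDigraph.twistedLaplacian_map]
    congr 1
  have h2 (i : G) : Γ.twistedLaplacian (fun e => C (a e))
        (fun e => ((C : R →+* R[X]).toMonoidHom.comp (χ i)) (Γ.ν e)) =
      (Γ.twistedLaplacian a fun e => χ i (Γ.ν e)).map C := by
    rw [WeightedDigraph.twistedLaplacian_map]
    rfl
  have h3 : (Γ.twistedLaplacian a fun e => χ 1 (Γ.ν e)) = Γ.twistedLaplacian a 1 := by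
    rw [hχ1]
    rfl
  simp only [h1, h2] at key
  -- In the product rule, every term that leaves the factor of the trivial character
  -- undifferentiated vanishes at `0`, by `h3` and `det_twistedLaplacian_one`.
  replace key := congrArg (fun q => (derivative q).eval 0) key
  beta_reduce at key
  rw [eval_zero_derivative_det_add_diagonal _ (fun q : V × G => d q.1),
    ← Finset.mul_prod_erase _ _ (Finset.mem_univ 1), derivative_mul, eval_add, eval_mul, eval_mul,
    eval_zero_derivative_det_add_diagonal, eval_zero_det_add_diagonal, h3,
    WeightedDigraph.det_twistedLaplacian_one, zero_mul, add_zero, eval_prod] at key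
  simp only [eval_zero_det_add_diagonal, Fintype.sum_prod_type,
    Γ.derived_adjugate_twistedLaplacian a _ _, d, Pi.single_apply, ite_mul, one_mul, zero_mul,
    Finset.sum_const, Finset.card_univ, nsmul_eq_mul, mul_ite, mul_zero, Finset.sum_ite_eq',
    Finset.mem_univ, if_true] at key
  rw [Γ.derived_adjugate_twistedLaplacian a, key]

end VoltageGraph

/-! ### The norm on polynomial rings as a product of conjugates. -/

section Norm

theorem det_galoisConjugates_ne_zero {F K : Type*} [Field F] [Field K] [Algebra F K]
    [FiniteDimensional F K] [IsGalois F K] [DecidableEq (K ≃ₐ[F] K)]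
    (b : Module.Basis (K ≃ₐ[F] K) F K) :
    (Matrix.of fun (g i : K ≃ₐ[F] K) => g (b i)).det ≠ 0 := by
  intro h0
  -- The Gram matrix of the conjugates is the trace matrix, whose determinant, the discriminant, is
  -- nonzero.
  have h : (Matrix.of fun (g i : K ≃ₐ[F] K) => g (b i)).transpose *
      (Matrix.of fun (g i : K ≃ₐ[F] K) => g (b i)) =
        (algebraMap F K).mapMatrix (Algebra.traceMatrix F b) := by
    ext i j
    rw [RingHom.mapMatrix_apply, Matrix.map_apply, Algebra.traceMatrix_apply,
      Algebra.traceForm_apply, trace_eq_sum_automorphisms]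
    simp [Matrix.mul_apply]
  have h' := congrArg Matrix.det h
  rw [Matrix.det_mul, h0, mul_zero, ← RingHom.map_det] at h'
  exact Algebra.discr_not_zero_of_basis F b ((map_eq_zero _).1 h'.symm)

attribute [local instance] MvPolynomial.algebraMvPolynomial

theorem exists_basis_mvPolynomial (σ : Type*) {F K ι : Type*} [Field F] [Field K] [Algebra F K]
    (b : Module.Basis ι F K) :
    ∃ B : Module.Basis ι (MvPolynomial σ F) (MvPolynomial σ K),
      ∀ i, B i = MvPolynomial.C (b i) := by
  have hpush : Algebra.IsPushout F (MvPolynomial σ F) K (MvPolynomial σ K) := inferInstance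
  refine ⟨hpush.out.basis b, fun i => ?_⟩
  rw [IsBaseChange.basis_apply]
  rfl

theorem map_det_leftMulMatrix {σ F K : Type*} [Field F] [Field K] [Algebra F K]
    [FiniteDimensional F K] [IsGalois F K] [DecidableEq (K ≃ₐ[F] K)]
    (b : Module.Basis (K ≃ₐ[F] K) F K)
    (B : Module.Basis (K ≃ₐ[F] K) (MvPolynomial σ F) (MvPolynomial σ K))
    (hB : ∀ i, B i = MvPolynomial.C (b i)) (α : MvPolynomial σ K) :
    MvPolynomial.map (algebraMap F K) (Algebra.leftMulMatrix B α).det =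
      ∏ g : K ≃ₐ[F] K, MvPolynomial.map (g : K →+* K) α := by
  let S : Matrix (K ≃ₐ[F] K) (K ≃ₐ[F] K) (MvPolynomial σ K) :=
    (MvPolynomial.C : K →+* MvPolynomial σ K).mapMatrix (Matrix.of fun g i => g (b i))
  have hS : S.det ≠ 0 := by
    rw [← RingHom.map_det]
    exact MvPolynomial.C_ne_zero.2 (det_galoisConjugates_ne_zero b)
  -- Applying `g` to the expansion of `α * B i` fixes the coefficients, which lie over `F`. So `S`
  -- conjugates multiplication by `α` to the diagonal of its conjugates.
  have key : Matrix.diagonal (fun g : K ≃ₐ[F] K => MvPolynomial.map (g : K →+* K) α) * S =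
      S * (MvPolynomial.map (algebraMap F K)).mapMatrix (Algebra.leftMulMatrix B α) := by
    ext1 g i
    rw [Matrix.diagonal_mul, Matrix.mul_apply]
    have h := (B.sum_repr (α * B i)).symm
    simp only [← Algebra.leftMulMatrix_eq_repr_mul] at h
    simp only [Algebra.smul_def, hB] at h
    replace h := congrArg (MvPolynomial.map (g : K →+* K)) h
    rw [map_mul, map_sum, MvPolynomial.map_C] at h
    refine h.trans (Finset.sum_congr rfl fun k _ => ?_)
    have hg : (g : K →+* K).comp (algebraMap F K) = algebraMap F K := RingHom.ext g.commutes
    rw [map_mul, MvPolynomial.map_C, MvPolynomial.algebraMap_def, MvPolynomial.map_map, hg,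
      mul_comm]
    rfl
  apply mul_left_cancel₀ hS
  rw [RingHom.map_det, ← Matrix.det_mul, ← key, Matrix.det_mul, Matrix.det_diagonal, mul_comm]

/-- The norm of a polynomial over a Galois number field is the product of its conjugates. -/
theorem map_polynomialNorm (σ : Type*) {K : Type*} [Field K] [NumberField K] [IsGalois ℚ K]
    (α : MvPolynomial σ K) :
    MvPolynomial.map (algebraMap ℚ K) (polynomialNorm σ K α) =
      ∏ g : K ≃ₐ[ℚ] K, MvPolynomial.map (g : K →+* K) α := by
  classical
  have hcard : Fintype.card (K ≃ₐ[ℚ] K) = Module.finrank ℚ K := by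
    rw [← Nat.card_eq_fintype_card, IsGalois.card_aut_eq_finrank]
  obtain ⟨B, hB⟩ := exists_basis_mvPolynomial σ
    ((Module.finBasis ℚ K).reindex (Fintype.equivFinOfCardEq hcard).symm)
  have hnorm : polynomialNorm σ K α = (Algebra.leftMulMatrix B α).det :=
    Algebra.norm_eq_matrix_det B α
  rw [hnorm, map_det_leftMulMatrix _ B hB]

end Norm

/-! ### Specialization to `ℤ/pℤ` and the cyclotomic field. -/

theorem map_arborescenceSum {V E σ R S : Type*} [CommRing R] [CommRing S] [Fintype E]
    (Γ : WeightedDigraph V E σ) (f : R →+* S) (v : V) :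
    MvPolynomial.map f (Γ.arborescenceSum R v) = Γ.arborescenceSum S v := by
  simp [WeightedDigraph.arborescenceSum, map_sum, map_prod]

section Cyclotomic

variable (p : ℕ) [Fact p.Prime] {K : Type*} [Field K]

theorem prod_galois_eq_prod_cyclotomicAut [NumberField K] [IsCyclotomicExtension {p} ℚ K]
    {M : Type*} [CommMonoid M] (F : (K ≃ₐ[ℚ] K) → M) :
    ∏ g, F g = ∏ i ∈ Finset.Icc 1 (p - 1), F (cyclotomicAut p K i) := by
  have hp : p.Prime := Fact.out
  have hcop {i : ℕ} (hi : i ∈ Finset.Icc 1 (p - 1)) : i.Coprime p := by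
    rw [Finset.mem_Icc] at hi
    exact (Nat.coprime_of_lt_prime (by lia) (by lia) hp).symm
  symm
  refine Finset.prod_bij (fun i _ => cyclotomicAut p K i) (fun _ _ => Finset.mem_univ _) ?_ ?_
    fun _ _ => rfl
  · intro i hi j hj hij
    rw [cyclotomicAut, cyclotomicAut, dif_pos (hcop hi), dif_pos (hcop hj)] at hij
    replace hij := congrArg Units.val ((MulEquiv.injective _) hij)
    rw [ZMod.coe_unitOfCoprime, ZMod.coe_unitOfCoprime, ZMod.natCast_eq_natCast_iff'] at hij
    rw [Finset.mem_Icc] at hi hj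
    rwa [Nat.mod_eq_of_lt (by lia), Nat.mod_eq_of_lt (by lia)] at hij
  · intro g _
    let u := IsCyclotomicExtension.Rat.galEquivZMod p K g
    have hu : (u : ZMod p).val ∈ Finset.Icc 1 (p - 1) := by
      have h0 : (u : ZMod p).val ≠ 0 := fun h => u.ne_zero ((ZMod.val_eq_zero _).1 h)
      have h1 := (u : ZMod p).val_lt
      rw [Finset.mem_Icc]
      lia
    refine ⟨(u : ZMod p).val, hu, ?_⟩
    rw [cyclotomicAut, dif_pos (hcop hu), MulEquiv.symm_apply_eq]
    ext
    simp [u]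

variable {ζ : K} (hζ : IsPrimitiveRoot ζ p)

/-- The characters of `ℤ/pℤ` with values in the `p`-th roots of unity, as constant polynomials. -/
def polynomialCharacter (σ : Type*) (i : Multiplicative (ZMod p)) :
    Multiplicative (ZMod p) →* MvPolynomial σ K :=
  (MvPolynomial.C : K →+* MvPolynomial σ K).toMonoidHom.comp
    (AddChar.mulShift (AddChar.zmodChar p hζ.pow_eq_one) i.toAdd).toMonoidHom

theorem polynomialCharacter_apply (σ : Type*) (i x : Multiplicative (ZMod p)) :
    polynomialCharacter p hζ σ i x =
      MvPolynomial.C (AddChar.zmodChar p hζ.pow_eq_one (i.toAdd * x.toAdd)) :=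
  rfl

theorem polynomialCharacter_one (σ : Type*) : polynomialCharacter p hζ σ 1 = 1 := by
  ext x
  simp [polynomialCharacter_apply]

theorem det_polynomialCharacter_ne_zero [CharZero K] (σ : Type*) :
    (Matrix.of fun x i => polynomialCharacter p hζ σ i x).det ≠ 0 := by
  set ψ := AddChar.zmodChar p hζ.pow_eq_one with hψ
  have hψp : ψ.IsPrimitive := AddChar.zmodChar_primitive_of_primitive_root p hζ
  let F : Matrix (Multiplicative (ZMod p)) (Multiplicative (ZMod p)) K :=
    Matrix.of fun x i => ψ (i.toAdd * x.toAdd)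
  let F' : Matrix (Multiplicative (ZMod p)) (Multiplicative (ZMod p)) K :=
    Matrix.of fun i x => ψ (-(i.toAdd * x.toAdd))
  -- Orthogonality of characters.
  have h : F * F' = (p : K) • (1 : Matrix _ _ K) := by
    ext x y
    have := AddChar.sum_mulShift (x.toAdd - y.toAdd) hψp
    simp only [F, F', Matrix.mul_apply, Matrix.of_apply, ← AddChar.map_add_eq_mul,
      ← sub_eq_add_neg, ← mul_sub, Matrix.smul_apply, Matrix.one_apply, smul_eq_mul]
    refine (Fintype.sum_equiv Multiplicative.toAdd _
      (fun i => ψ (i * (x.toAdd - y.toAdd))) fun _ => rfl).trans ?_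
    rw [this]
    simp [sub_eq_zero]
  have hF : F.det ≠ 0 := by
    intro h0
    have h' := congrArg Matrix.det h
    rw [Matrix.det_mul, h0, zero_mul, Matrix.det_smul, Matrix.det_one, mul_one] at h'
    exact pow_ne_zero _ (Nat.cast_ne_zero.2 (Fact.out : p.Prime).ne_zero) h'.symm
  have hC : (Matrix.of fun x i => polynomialCharacter p hζ σ i x) =
    (MvPolynomial.C : K →+* MvPolynomial σ K).mapMatrix F := rfl
  rw [hC, ← RingHom.map_det]
  exact MvPolynomial.C_ne_zero.2 hF

variable {V E σ : Type*} [DecidableEq V] [Fintype E]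
  (Γ : VoltageGraph V E σ (Multiplicative (ZMod p)))

theorem cyclotomicLaplacian_eq :
    cyclotomicLaplacian p hζ Γ = Γ.twistedLaplacian (fun e => MvPolynomial.X (Γ.wt e))
      fun e => MvPolynomial.C (ζ ^ (Γ.ν e).toAdd.val) := by
  have hv (e : E) : reducedToField p hζ (Γ.voltage e) = ζ ^ (Γ.ν e).toAdd.val :=
    groupAlgebraToField_of p hζ (Γ.ν e)
  ext1 u w
  simp only [cyclotomicLaplacian, VoltageGraph.voltageLaplacian, WeightedDigraph.degreeMatrix,
    VoltageGraph.voltageAdjacency, Matrix.map_apply, Matrix.sub_apply, Matrix.of_apply, map_sub,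
    map_sum, map_mul, MvPolynomial.map_C, MvPolynomial.map_X, hv, Matrix.diagonal_apply,
    WeightedDigraph.twistedLaplacian, mul_sub, Finset.sum_sub_distrib,
    apply_ite (MvPolynomial.map (reducedToField p hζ)), map_zero, mul_ite, mul_zero, mul_one,
    Finset.sum_ite_irrel, Finset.sum_const_zero]
  congr 1
  rw [← Finset.sum_filter, Finset.filter_filter]
  exact Finset.sum_congr rfl fun e _ => mul_comm _ _

/-- Raising `ζ` to the power `i` turns the tautological character into its `i`-th power: conjugates
are twists. -/
theorem cyclotomicLaplacian_map_cyclotomicAut [NumberField K] [IsCyclotomicExtension {p} ℚ K]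
    {i : ℕ} (hi : i.Coprime p) :
    (cyclotomicLaplacian p hζ Γ).map (MvPolynomial.map (cyclotomicAut p K i : K →+* K)) =
      Γ.twistedLaplacian (fun e => MvPolynomial.X (Γ.wt e))
        fun e => polynomialCharacter p hζ σ (Multiplicative.ofAdd (i : ZMod p)) (Γ.ν e) := by
  rw [cyclotomicLaplacian_eq, WeightedDigraph.twistedLaplacian_map]
  congr 1
  · ext1 e
    simp
  · ext1 e
    rw [polynomialCharacter_apply, Function.comp_apply, MvPolynomial.map_C]
    congr 1
    have : (Multiplicative.ofAdd (i : ZMod p)).toAdd * (Γ.ν e).toAdd =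
        ((i * (Γ.ν e).toAdd.val : ℕ) : ZMod p) := by simp
    rw [this, AddChar.zmodChar_apply' hζ.pow_eq_one, pow_mul, ← cyclotomicAut_apply p hζ hi]
    simp

/-- The identity for the arborescence sums over the cyclotomic field. -/
theorem card_mul_arborescenceSum_derived [Fintype V] [NumberField K]
    [IsCyclotomicExtension {p} ℚ K] (v : V) (x : Multiplicative (ZMod p)) :
    (p : MvPolynomial σ K) * Γ.derived.arborescenceSum K (v, x) =
      Γ.arborescenceSum K v * ∏ i ∈ Finset.Icc 1 (p - 1),
        ((cyclotomicLaplacian p hζ Γ).map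
          (MvPolynomial.map (cyclotomicAut p K i : K →+* K))).det := by
  have hp : p.Prime := Fact.out
  have h := Γ.card_mul_adjugate_derived_twistedLaplacian
    (fun e => MvPolynomial.X (R := K) (Γ.wt e)) (polynomialCharacter p hζ σ)
    (det_polynomialCharacter_ne_zero p hζ σ) (polynomialCharacter_one p hζ σ) v x
  rw [WeightedDigraph.adjugate_twistedLaplacian_one, Fintype.card_multiplicative, ZMod.card] at h
  have h' := Γ.derived.adjugate_twistedLaplacian_one (R := K) (v, x)
  change (Γ.derived.twistedLaplacian (fun e => MvPolynomial.X (Γ.wt e.1)) 1).adjugate _ _ = _ at h'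
  rw [← h', h]
  congr 1
  symm
  refine Finset.prod_bij (fun i _ => Multiplicative.ofAdd (i : ZMod p)) ?_ ?_ ?_ ?_
  · intro i hi
    rw [Finset.mem_Icc] at hi
    refine Finset.mem_erase.2 ⟨fun h0 => ?_, Finset.mem_univ _⟩
    have : (i : ZMod p) = 0 := h0
    rw [ZMod.natCast_eq_zero_iff] at this
    exact absurd (Nat.le_of_dvd (by lia) this) (by lia)
  · intro i hi j hj hij
    replace hij : (i : ZMod p) = j := hij
    rw [ZMod.natCast_eq_natCast_iff'] at hij
    rw [Finset.mem_Icc] at hi hj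
    rwa [Nat.mod_eq_of_lt (by lia), Nat.mod_eq_of_lt (by lia)] at hij
  · intro g hg
    have h0 : g.toAdd.val ≠ 0 := fun h =>
      (Finset.mem_erase.1 hg).1 ((ZMod.val_eq_zero g.toAdd).1 h)
    have h1 := g.toAdd.val_lt
    refine ⟨g.toAdd.val, Finset.mem_Icc.2 (by lia), ?_⟩
    rw [ZMod.natCast_zmod_val]
    rfl
  · intro i hi
    rw [Finset.mem_Icc] at hi
    rw [cyclotomicLaplacian_map_cyclotomicAut p hζ Γ
      (Nat.coprime_of_lt_prime (by lia) (by lia) hp).symm]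

end Cyclotomic

theorem algebraMap_div_algebraMap_of_mul_eq {R : Type*} [CommRing R] [IsDomain R] {n : ℕ}
    {A A' N : R} (hn : (n : R) ≠ 0) (hA : A ≠ 0) (h : n * A' = A * N) :
    algebraMap R (FractionRing R) A' / algebraMap R (FractionRing R) A =
      1 / (n : FractionRing R) * algebraMap R (FractionRing R) N := by
  have hinj := IsFractionRing.injective R (FractionRing R)
  have hA' : algebraMap R (FractionRing R) A ≠ 0 := (map_ne_zero_iff _ hinj).2 hA
  have hn' : (n : FractionRing R) ≠ 0 := by
    rw [← map_natCast (algebraMap R (FractionRing R))]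
    exact (map_ne_zero_iff _ hinj).2 hn
  have h' := congrArg (algebraMap R (FractionRing R)) h
  rw [map_mul, map_mul, map_natCast] at h'
  rw [div_eq_iff hA', one_div, mul_assoc, eq_inv_mul_iff_mul_eq₀ hn', h', mul_comm]

end

end ArborescenceCover

theorem corollary1p3
    (p : ℕ) [Fact p.Prime]
    {V E σ : Type*} [Fintype V] [DecidableEq V] [Fintype E]
    (Γ : ArborescenceCover.VoltageGraph V E σ (Multiplicative (ZMod p)))
    {K : Type*} [Field K] [NumberField K] [IsCyclotomicExtension {p} ℚ K]
    {ζ : K} (hζ : IsPrimitiveRoot ζ p)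
    (v : V) (x : Multiplicative (ZMod p)) :
    -- `A = A_v(Γ)`, and `A' = A_ṽ(Γ̃)` for the lift `ṽ = (v, x)` of `v`
    let A : MvPolynomial σ ℚ := Γ.arborescenceSum ℚ v
    let A' : MvPolynomial σ ℚ := Γ.derived.arborescenceSum ℚ (v, x)
    let L : Matrix V V (MvPolynomial σ K) := ArborescenceCover.cyclotomicLaplacian p hζ Γ
    let N : MvPolynomial σ ℚ := ArborescenceCover.polynomialNorm σ K L.det
    let P : MvPolynomial σ K := ∏ i ∈ Finset.Icc 1 (p - 1),
      (L.map (MvPolynomial.map (ArborescenceCover.cyclotomicAut p K i : K →+* K))).det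
    let ι : MvPolynomial σ ℚ →+* MvPolynomial σ K := MvPolynomial.map (algebraMap ℚ K)
    -- the identities with denominators cleared, valid also if `A = 0`
    ((p : MvPolynomial σ ℚ) * A' = A * N ∧ ι N = P) ∧
    -- the two formulas for the ratio, in the fields of rational functions over `ℚ` and over `K`
    (A ≠ 0 →
      (algebraMap _ (FractionRing (MvPolynomial σ ℚ)) A' /
          algebraMap _ (FractionRing (MvPolynomial σ ℚ)) A =
        1 / (p : FractionRing (MvPolynomial σ ℚ)) *
          algebraMap _ (FractionRing (MvPolynomial σ ℚ)) N) ∧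
      (algebraMap _ (FractionRing (MvPolynomial σ K)) (ι A') /
          algebraMap _ (FractionRing (MvPolynomial σ K)) (ι A) =
        1 / (p : FractionRing (MvPolynomial σ K)) *
          algebraMap _ (FractionRing (MvPolynomial σ K)) P)) := by
  intro A A' L N P ι
  have : IsGalois ℚ K := IsCyclotomicExtension.isGalois {p} ℚ K
  have hp : p.Prime := Fact.out
  have hι : Function.Injective ι :=
    MvPolynomial.map_injective _ (algebraMap ℚ K).injective
  have hNP : ι N = P := by
    refine (ArborescenceCover.map_polynomialNorm σ L.det).trans ?_
    rw [ArborescenceCover.prod_galois_eq_prod_cyclotomicAut p]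
    exact Finset.prod_congr rfl fun i _ => RingHom.map_det _ _
  have hP : (p : MvPolynomial σ K) * ι A' = ι A * P := by
    have h := ArborescenceCover.card_mul_arborescenceSum_derived p hζ Γ v x
    rwa [← ArborescenceCover.map_arborescenceSum _ (algebraMap ℚ K),
      ← ArborescenceCover.map_arborescenceSum Γ.toWeightedDigraph (algebraMap ℚ K)] at h
  -- The characters need `K`, but both sides have rational coefficients, so the identity descends
  -- along the injection `ι`.
  have hN : (p : MvPolynomial σ ℚ) * A' = A * N := by
    apply hι
    rw [map_mul, map_mul, map_natCast, hNP, hP]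
  refine ⟨⟨hN, hNP⟩, fun hA => ⟨?_, ?_⟩⟩
  · exact ArborescenceCover.algebraMap_div_algebraMap_of_mul_eq
      (Nat.cast_ne_zero.2 hp.ne_zero) hA hN
  · exact ArborescenceCover.algebraMap_div_algebraMap_of_mul_eq
      (Nat.cast_ne_zero.2 hp.ne_zero) ((map_ne_zero_iff ι hι).2 hA) hP
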